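/- Let $l,w\ge 1$ be integers. For $i\in\{1,2\}$ let the hammock network $H^{(i)}_{l,w}$ be the undirected graph whose nodes are the points $(x,y)\in\mathbb Z^2$ with $0\le x\le l$, $0\le y\le w$ and $x+y$ even (if $i=1$) or odd (if $i=2$), and whose edges join any two nodes $(x,y)$, $(x',y')$ with $|x-x'|=|y-y'|=1$; its source nodes are the nodes with $x=0$ and its terminus nodes are the nodes with $x=l$. A set of edges is a pathset if it contains a path from some source node to some terminus node. The reliability polynomial is $$h^{(i)}_{l,w}(p)=\sum_{P}p^{|P|}(1-p)^{n-|P|},$$ where $P$ runs over all pathsets of $H^{(i)}_{l,w}$ and $n$ is its number of edges; for $p\in[0,1]$ this is the probability that the closed edges form a pathset when each edge is closed with probability $p$, independently of the others. Suppose that at least one of $l$ and $w$ is odd. Then $H^{(1)}_{l,w}$ and $H^{(2)}_{l,w}$ are isomorphic as two-terminal networks (there is a graph isomorphism that maps the unordered pair formed by the set of sources and the set of termini of one network to that of the other), and $h^{(1)}_{l,w}=h^{(2)}_{l,w}=:h_{l,w}$; likewise $h_{w,l}$ is well defined. For all $p\in[0,1]$, $$h_{l,w}(p)=1-h_{w,l}(1-p).$$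 Consequently the graphs of $h_{l,w}$ and $h_{w,l}$ over $[0,1]$ are symmetric to each other with respect to the point $(\tfrac12,\tfrac12)$: the point reflection in $(\tfrac12,\tfrac12)$ maps one onto the other. In particular, for every integer $k\ge 0$, the graph of $h_{2k+1,2k+1}$ over $[0,1]$ is centrally symmetric about $(\tfrac12,\tfrac12)$. -/

import Mathlib

/-- A network on the node type `V`: an undirected graph together with its input (source) nodes and
its output (terminus) nodes. The source nodes stand for one terminal `S` and the terminus nodes for
one terminal `T`. -/
structure Network (V : Type*) where
  graph : SimpleGraph V
  sources : Set V
  termini : Set V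

namespace Network

variable {V W : Type*}

/-- A pathset is a set of edges that contains a path (with pairwise distinct nodes) from some source
node to some terminus node. -/
def IsPathset (N : Network V) (P : Set (Sym2 V)) : Prop :=
  P ⊆ N.graph.edgeSet ∧
    ∃ s ∈ N.sources, ∃ t ∈ N.termini, ∃ γ : N.graph.Walk s t,
      γ.IsPath ∧ ∀ e ∈ γ.edges, e ∈ P

open Classical in
/-- The two-terminal reliability polynomial `∑ p ^ |P| * (1 - p) ^ (|E| - |P|)`, summed over all
pathsets `P`, where `E` is the set of all edges: its value at `p` is the probability that the closed
edges contain a path from a source to a terminus, when the edges are independently closed with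
probability `p` and open with probability `1 - p`. -/
noncomputable def reliabilityPolynomial [Fintype V] (N : Network V) : Polynomial ℝ :=
  ∑ P ∈ N.graph.edgeFinset.powerset.filter
      fun P : Finset (Sym2 V) => N.IsPathset (P : Set (Sym2 V)),
    Polynomial.X ^ P.card * (1 - Polynomial.X) ^ (N.graph.edgeFinset.card - P.card)

/-- Two networks are isomorphic if some isomorphism of their graphs respects the pair of terminals
`{S, T}`. The edges are undirected, so that the names input and output may be interchanged. -/
def Isomorphic (N : Network V) (M : Network W) : Prop :=
  ∃ φ : N.graph ≃g M.graph,
    (φ '' N.sources = M.sources ∧ φ '' N.termini = M.termini) ∨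
    (φ '' N.sources = M.termini ∧ φ '' N.termini = M.sources)

end Network

/-- The two kinds of hammock networks. -/
inductive HammockKind
  | first
  | second

/-- The points `(x, y)` of the first kind have `x + y` even, those of the second kind have `x + y`
odd. -/
def HammockKind.HasParity : HammockKind → ℤ → Prop
  | .first, n => Even n
  | .second, n => Odd n

/-- The graph on `ℤ²` whose edges are the diagonal unit steps `(±1, ±1)`; its paths are the
`X`-paths. -/
def xGraph : SimpleGraph (ℤ × ℤ) where
  Adj u v := |u.1 - v.1| = 1 ∧ |u.2 - v.2| = 1
  symm := ⟨fun u v h => by rwa [abs_sub_comm v.1, abs_sub_comm v.2]⟩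
  loopless := ⟨fun u h => by simp at h⟩

open Classical in
/-- The points of parity `i` in the rectangle `[0, l] × [0, w]`. -/
noncomputable def hammockVertices (i : HammockKind) (l w : ℕ) : Finset (ℤ × ℤ) :=
  (Finset.Icc (0 : ℤ) l ×ˢ Finset.Icc (0 : ℤ) w).filter fun v => i.HasParity (v.1 + v.2)

/-- The hammock network of kind `i` with length `l` and width `w`: the nodes are the points of
parity `i` in `[0, l] × [0, w]`, the edges are the diagonal unit segments between them, the sources
are the nodes on the line `x = 0`, and the termini are the nodes on the line `x = l`. -/
noncomputable def hammock (i : HammockKind) (l w : ℕ) : Network (hammockVertices i l w) where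
  graph := xGraph.comap Subtype.val
  sources := {v | v.1.1 = 0}
  termini := {v | v.1.1 = (l : ℤ)}

/-- The reliability polynomial of the hammock network of kind `i` and dimensions `(l, w)`. -/
noncomputable def hammockPoly (i : HammockKind) (l w : ℕ) : Polynomial ℝ :=
  (hammock i l w).reliabilityPolynomial

/-- The graph over `[0, 1]` of the reliability polynomial of the hammock network of kind `i` and
dimensions `(l, w)`. -/
noncomputable def hammockPlot (i : HammockKind) (l w : ℕ) : Set (ℝ × ℝ) :=
  (Set.Icc (0 : ℝ) 1).graphOn fun p => (hammockPoly i l w).eval p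

/-! ### Kinds, nodes, cells and diagonal steps. -/

open Relation

/-! Each unit cell of the rectangle has two diagonals, one joining nodes of each kind, so the edges
of both networks are named by the same cells (`edgeCell_bijOn`). The core is planar duality: a set
`S` of closed cells carries a left-right path of kind `i` iff its complement carries no bottom-top
path of the other kind (`cellCrossing_other_iff_not`).

Not both exist: the signed number of passages of the first path below a point, corrected at its end,
is constant along a path of the other kind through other cells, yet it is 0 at the bottom and 1 at
the top (`not_disjoint_of_crossing`). One exists: label nodes of kind `i` by reachability from the
left through `S`, the others by reachability from the bottom through the complement. Without
crossings, a boundary count modulo 2 forces a cell in which both diagonals have unequal end labels,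
although one of them can be traversed (`exists_crossing`).

Transposition makes the bottom-top path a left-right path of the `w` by `l` rectangle, and
complementation exchanges `p` and `1 - p`. This relates opposite kinds (`eval_hammockPoly_other`);
when `l` or `w` is odd, reflecting that coordinate identifies the kinds (`hammock_isomorphic`). -/

/-- The kind of the dual network. -/
def HammockKind.other : HammockKind → HammockKind
  | .first => .second
  | .second => .first

/-- The residue of the coordinate sums of the nodes of a given kind. -/
def HammockKind.residue : HammockKind → ℤ
  | .first => 0
  | .second => 1

theorem HammockKind.hasParity_iff (i : HammockKind) (n : ℤ) :
    i.HasParity n ↔ n % 2 = i.residue := by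
  cases i
  · exact Int.even_iff
  · exact Int.odd_iff

theorem HammockKind.residue_eq (i : HammockKind) : i.residue = 0 ∨ i.residue = 1 := by
  cases i <;> simp [HammockKind.residue]

theorem HammockKind.residue_other (i : HammockKind) : i.other.residue = 1 - i.residue := by
  cases i <;> simp [HammockKind.residue, HammockKind.other]

theorem mem_hammockVertices {i : HammockKind} {l w : ℕ} {v : ℤ × ℤ} :
    v ∈ hammockVertices i l w ↔
      0 ≤ v.1 ∧ v.1 ≤ l ∧ 0 ≤ v.2 ∧ v.2 ≤ w ∧ (v.1 + v.2) % 2 = i.residue := by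
  simp only [hammockVertices, Finset.mem_filter, Finset.mem_product, Finset.mem_Icc,
    HammockKind.hasParity_iff, and_assoc]

/-- The lower left corners of the unit cells of the rectangle `[0, l] × [0, w]`. -/
noncomputable def hammockCells (l w : ℕ) : Finset (ℤ × ℤ) := Finset.Ico (0 : ℤ) l ×ˢ Finset.Ico (0 : ℤ) w

theorem mem_hammockCells {l w : ℕ} {c : ℤ × ℤ} :
    c ∈ hammockCells l w ↔ 0 ≤ c.1 ∧ c.1 < l ∧ 0 ≤ c.2 ∧ c.2 < w := by
  simp only [hammockCells, Finset.mem_product, Finset.mem_Ico, and_assoc]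

/-- A diagonal step whose unit cell has its lower left corner in `S`. -/
def CellStep (S : Set (ℤ × ℤ)) (u v : ℤ × ℤ) : Prop :=
  xGraph.Adj u v ∧ (min u.1 v.1, min u.2 v.2) ∈ S

theorem xGraph_adj_iff {u v : ℤ × ℤ} :
    xGraph.Adj u v ↔ (v.1 = u.1 + 1 ∨ v.1 = u.1 - 1) ∧ (v.2 = u.2 + 1 ∨ v.2 = u.2 - 1) := by
  change |u.1 - v.1| = 1 ∧ |u.2 - v.2| = 1 ↔ _
  rw [abs_eq zero_le_one, abs_eq zero_le_one]
  omega

theorem CellStep.symm {S : Set (ℤ × ℤ)} {u v : ℤ × ℤ} (h : CellStep S u v) : CellStep S v u :=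
  ⟨h.1.symm, by rw [min_comm v.1, min_comm v.2]; exact h.2⟩

theorem CellStep.mem_hammockVertices {i : HammockKind} {l w : ℕ} {S : Set (ℤ × ℤ)}
    (hS : S ⊆ hammockCells l w) {u v : ℤ × ℤ} (h : CellStep S u v)
    (hu : u ∈ hammockVertices i l w) : v ∈ hammockVertices i l w := by
  have hc := mem_hammockCells.1 (Finset.mem_coe.1 (hS h.2))
  have ha := xGraph_adj_iff.1 h.1
  rw [_root_.mem_hammockVertices] at hu ⊢
  dsimp only at hc
  omega

theorem mem_hammockVertices_of_reflTransGen {i : HammockKind} {l w : ℕ} {S : Set (ℤ × ℤ)}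
    (hS : S ⊆ hammockCells l w) {u v : ℤ × ℤ} (h : ReflTransGen (CellStep S) u v)
    (hu : u ∈ hammockVertices i l w) : v ∈ hammockVertices i l w := by
  induction h with
  | refl => exact hu
  | tail _ h ih => exact h.mem_hammockVertices hS ih

/-! ### Paths of different kinds that cross share a cell. -/

/-- `F x y` counts, with sign, the crossings of the column `[x, x + 1]` below height `y`. -/
theorem exists_crossingCount {i : HammockKind} {l w : ℕ} {S : Set (ℤ × ℤ)}
    (hS : S ⊆ hammockCells l w) {a b : ℤ × ℤ} (h : ReflTransGen (CellStep S) a b)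
    (ha : a ∈ hammockVertices i l w) :
    ∃ F : ℤ → ℤ → ℤ, (∀ x y, (x, y) ∉ S → F x (y + 1) = F x y) ∧
      (∀ x y, (x + y) % 2 = i.other.residue →
        F x y - F (x - 1) y = (if a.1 = x ∧ a.2 < y then 1 else 0) -
          (if b.1 = x ∧ b.2 < y then 1 else 0)) ∧
      (∀ x, F x 0 = 0) ∧
      (∀ x, F x w = (if a.1 ≤ x then 1 else 0) - (if b.1 ≤ x then 1 else 0)) := by
  induction h with
  | refl => exact ⟨fun _ _ => 0, by simp⟩
  | @tail b c hab hbc ih =>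
    obtain ⟨F, h1, h2, h3, h4⟩ := ih
    have hb := mem_hammockVertices.1 (mem_hammockVertices_of_reflTransGen hS hab ha)
    have hadj := xGraph_adj_iff.1 hbc.1
    have hcell := mem_hammockCells.1 (Finset.mem_coe.1 (hS hbc.2))
    dsimp only at hcell
    -- The sign `c.1 - b.1` is 1 for a step to the right and -1 for a step to the left.
    refine ⟨fun x y => F x y + if min b.1 c.1 = x ∧ min b.2 c.2 < y then c.1 - b.1 else 0,
      fun x y hxy => ?_, fun x y hxy => ?_, fun x => ?_, fun x => ?_⟩
    · have : ¬ (min b.1 c.1 = x ∧ min b.2 c.2 = y) := by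
        rintro ⟨rfl, rfl⟩
        exact hxy hbc.2
      simp only [h1 x y hxy]
      congr 2
      rw [eq_iff_iff]
      omega
    · have e := h2 x y hxy
      rw [HammockKind.residue_other] at hxy
      dsimp only
      generalize (if a.1 = x ∧ a.2 < y then (1 : ℤ) else 0) = K at e ⊢
      split_ifs at e ⊢ <;> omega
    · simp only [h3 x]
      split_ifs <;> omega
    · have e := h4 x
      dsimp only
      generalize (if a.1 ≤ x then (1 : ℤ) else 0) = K at e ⊢
      split_ifs at e ⊢ <;> omega

/-- A left-right path and a bottom-top path of different kinds have a cell in common. -/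
theorem not_disjoint_of_crossing {i : HammockKind} {l w : ℕ} (hl : 1 ≤ l)
    {S S' : Set (ℤ × ℤ)} (hS : S ⊆ hammockCells l w) (hS' : S' ⊆ hammockCells l w)
    {a b c d : ℤ × ℤ} (ha : a ∈ hammockVertices i l w) (ha0 : a.1 = 0) (hb : b.1 = l)
    (hab : ReflTransGen (CellStep S) a b) (hc : c ∈ hammockVertices i.other l w) (hc0 : c.2 = 0)
    (hd : d.2 = w) (hcd : ReflTransGen (CellStep S') c d) : ¬ Disjoint S S' := by
  intro hdisj
  obtain ⟨F, h1, h2, h3, h4⟩ := exists_crossingCount hS hab ha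
  have hbV := mem_hammockVertices.1 (mem_hammockVertices_of_reflTransGen hS hab ha)
  -- On the right side the path ends and the count in the column beyond drops; the extra term
  -- restores the count of the column before it.
  let f : ℤ × ℤ → ℤ := fun v => F v.1 v.2 + if b.1 = v.1 ∧ b.2 < v.2 then 1 else 0
  have hstep : ∀ u v, u ∈ hammockVertices i.other l w → v ∈ hammockVertices i.other l w →
      v.1 = u.1 + 1 → CellStep S' u v → f u = f v := by
    intro u v hu hv huv h
    have hadj := xGraph_adj_iff.1 h.1
    have hns : (min u.1 v.1, min u.2 v.2) ∉ S := fun hm => Set.disjoint_left.1 hdisj hm h.2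
    have hx : min u.1 v.1 = u.1 := by omega
    have e1 := h1 _ _ hns
    rw [mem_hammockVertices] at hu hv
    have e2 := h2 v.1 v.2 hv.2.2.2.2
    have hx' : v.1 - 1 = u.1 := by omega
    rw [if_neg (by omega : ¬ (a.1 = v.1 ∧ a.2 < v.2)), hx'] at e2
    rw [hx] at e1
    simp only [f]
    rw [if_neg (by omega : ¬ (b.1 = u.1 ∧ b.2 < u.2))]
    have e3 : F u.1 u.2 = F u.1 v.2 := by
      rcases hadj.2 with h | h
      · rw [min_eq_left (by omega)] at e1
        rw [h, e1]
      · rw [min_eq_right (by omega)] at e1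
        rw [show u.2 = v.2 + 1 by omega, e1]
    omega
  have hf : f d = f c := by
    clear hd
    induction hcd with
    | refl => rfl
    | @tail u v hcu huv ih =>
      have hu := mem_hammockVertices_of_reflTransGen hS' hcu hc
      have hv := huv.mem_hammockVertices hS' hu
      rw [← ih]
      rcases (xGraph_adj_iff.1 huv.1).1 with h | h
      · exact (hstep u v hu hv h huv).symm
      · exact hstep v u hv hu (by omega) huv.symm
  have hdV := mem_hammockVertices.1 (mem_hammockVertices_of_reflTransGen hS' hcd hc)
  have hw := h4 d.1
  simp only [f, hd, hc0, h3, hw] at hf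
  -- This handles `d.1 = l`: comparing the last two columns forces `b.2 < w`, so that `f d = 1`
  -- there too.
  have e := h2 d.1 d.2 hdV.2.2.2.2
  rw [hd, hw, h4] at e
  split_ifs at hf e <;> omega

/-! ### Existence of a crossing, by a boundary count modulo 2. -/

theorem sum_range_add_succ_of_charTwo {R : Type*} [Ring R] [CharP R 2] (f : ℕ → R) (n : ℕ) :
    ∑ k ∈ Finset.range n, (f k + f (k + 1)) = f 0 + f n := by
  induction n with
  | zero => simp [CharTwo.add_self_eq_zero]
  | succ n ih => rw [Finset.sum_range_succ, ih, add_assoc, CharTwo.add_cancel_left]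

/-- Stokes' theorem modulo two for the products along the sides of the cells of a rectangle. -/
theorem sum_cells_eq_sum_boundary (s : ℕ → ℕ → ZMod 2) (l w : ℕ) :
    ∑ x ∈ Finset.range l, ∑ y ∈ Finset.range w,
        (s x y + s (x + 1) (y + 1)) * (s (x + 1) y + s x (y + 1)) =
      ∑ x ∈ Finset.range l, (s x 0 * s (x + 1) 0 + s x w * s (x + 1) w) +
        ∑ y ∈ Finset.range w, (s 0 y * s 0 (y + 1) + s l y * s l (y + 1)) := by
  -- The four terms belong to the four sides of the cell; opposite sides are paired so that each
  -- pair telescopes.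
  have e : ∀ x y, (s x y + s (x + 1) (y + 1)) * (s (x + 1) y + s x (y + 1)) =
      (s x y * s (x + 1) y + s x (y + 1) * s (x + 1) (y + 1)) +
        (s x y * s x (y + 1) + s (x + 1) y * s (x + 1) (y + 1)) := fun x y => by ring
  simp only [e, Finset.sum_add_distrib (f := fun y => s _ y * s _ y + _)]
  rw [Finset.sum_add_distrib]
  congr 1
  · exact Finset.sum_congr rfl fun x _ =>
      sum_range_add_succ_of_charTwo (fun y => s x y * s (x + 1) y) w
  · rw [Finset.sum_comm]
    exact Finset.sum_congr rfl fun y _ =>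
      sum_range_add_succ_of_charTwo (fun x => s x y * s x (y + 1)) l

/-- If `a` or `b` is 1 then `(a + 1) * (b + 1) = 0`, so modulo 2 the product is `a + b + 1`, whose
sum telescopes. -/
theorem sum_range_mul_succ_of_or {s : ℕ → ZMod 2} {n : ℕ}
    (h : ∀ k < n, s k = 1 ∨ s (k + 1) = 1) :
    ∑ k ∈ Finset.range n, s k * s (k + 1) = s 0 + s n + n := by
  have e : ∀ k ∈ Finset.range n, s k * s (k + 1) = (s k + s (k + 1)) + 1 := by
    intro k hk
    have := h k (Finset.mem_range.1 hk)
    generalize s k = a, s (k + 1) = b at this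
    revert a b
    decide
  rw [Finset.sum_congr rfl e, Finset.sum_add_distrib, sum_range_add_succ_of_charTwo]
  simp

/-- A labelling of a rectangle whose boundary labels have winding number one has a cell in which
both diagonals have distinct labels at their ends. -/
theorem exists_cell_of_boundary (s : ℕ → ℕ → ZMod 2) (l w r : ℕ)
    (hleft : ∀ y ≤ w, y % 2 = r % 2 → s 0 y = 1)
    (hright : ∀ y ≤ w, (l + y) % 2 = r % 2 → s l y = 0)
    (hbot : ∀ x ≤ l, x % 2 ≠ r % 2 → s x 0 = 1)
    (htop : ∀ x ≤ l, (x + w) % 2 ≠ r % 2 → s x w = 0) :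
    ∃ x < l, ∃ y < w, s x y ≠ s (x + 1) (y + 1) ∧ s (x + 1) y ≠ s x (y + 1) := by
  by_contra! hcon
  have h0 : ∑ x ∈ Finset.range l, ∑ y ∈ Finset.range w,
        (s x y + s (x + 1) (y + 1)) * (s (x + 1) y + s x (y + 1)) = 0 := by
    refine Finset.sum_eq_zero fun x hx => Finset.sum_eq_zero fun y hy => ?_
    have := hcon x (Finset.mem_range.1 hx) y (Finset.mem_range.1 hy)
    by_cases h : s x y = s (x + 1) (y + 1)
    · rw [h, CharTwo.add_self_eq_zero, zero_mul]
    · rw [this h, CharTwo.add_self_eq_zero, mul_zero]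
  rw [sum_cells_eq_sum_boundary, Finset.sum_add_distrib, Finset.sum_add_distrib,
    sum_range_mul_succ_of_or (s := fun x => s x 0), sum_range_mul_succ_of_or (s := fun y => s 0 y),
    Finset.sum_eq_zero (f := fun x => s x w * s (x + 1) w),
    Finset.sum_eq_zero (f := fun y => s l y * s l (y + 1))] at h0
  -- The top and right sums vanish and `s 0 0` cancels, leaving `s l 0 + s 0 w + l + w`. Each of
  -- these two corners is fixed by one of its two sides, according to parity, and the total is 1.
  · have el : s l 0 = ((l + r : ℕ) : ZMod 2) := by
      by_cases h : l % 2 = r % 2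
      · rw [hright 0 (Nat.zero_le _) h, (ZMod.natCast_eq_zero_iff_even).2]
        rw [Nat.even_iff]; omega
      · rw [hbot l le_rfl h, (ZMod.natCast_eq_one_iff_odd).2]
        rw [Nat.odd_iff]; omega
    have ew : s 0 w = ((w + r + 1 : ℕ) : ZMod 2) := by
      by_cases h : w % 2 = r % 2
      · rw [hleft w le_rfl h, (ZMod.natCast_eq_one_iff_odd).2]
        rw [Nat.odd_iff]; omega
      · rw [htop 0 (Nat.zero_le _) (by simpa using h), (ZMod.natCast_eq_zero_iff_even).2]
        rw [Nat.even_iff]; omega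
    rw [el, ew] at h0
    push_cast at h0
    generalize s 0 0 = a, (l : ZMod 2) = b, (w : ZMod 2) = c, (r : ZMod 2) = d at h0
    revert a b c d
    decide
  · intro y hy
    have hy := Finset.mem_range.1 hy
    by_cases h : (l + y) % 2 = r % 2
    · rw [hright y hy.le h, zero_mul]
    · rw [hright (y + 1) hy (by omega), mul_zero]
  · intro x hx
    have hx := Finset.mem_range.1 hx
    by_cases h : (x + w) % 2 = r % 2
    · rw [htop (x + 1) hx (by omega), mul_zero]
    · rw [htop x hx.le h, zero_mul]
  · intro y hy
    by_cases h : y % 2 = r % 2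
    · exact .inl (hleft y hy.le h)
    · exact .inr (hleft (y + 1) hy (by omega))
  · intro x hx
    by_cases h : x % 2 = r % 2
    · exact .inr (hbot (x + 1) hx (by omega))
    · exact .inl (hbot x hx.le h)

/-- If the cells in `S` contain no left-right path of one kind, then the other cells contain a
bottom-top path of the other kind. -/
theorem exists_crossing {i : HammockKind} {l w : ℕ} {S : Set (ℤ × ℤ)}
    (h : ¬ ∃ a b : ℤ × ℤ, a ∈ hammockVertices i l w ∧ a.1 = 0 ∧ b.1 = l ∧
      ReflTransGen (CellStep S) a b) :
    ∃ c d : ℤ × ℤ, c ∈ hammockVertices i.other l w ∧ c.2 = 0 ∧ d.2 = w ∧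
      ReflTransGen (CellStep (hammockCells l w \ S)) c d := by
  by_contra h'
  push Not at h h'
  classical
  let A : ℤ × ℤ → Prop := fun u =>
    ∃ a ∈ hammockVertices i l w, a.1 = 0 ∧ ReflTransGen (CellStep S) a u
  let C : ℤ × ℤ → Prop := fun u =>
    ∃ c ∈ hammockVertices i.other l w, c.2 = 0 ∧
      ReflTransGen (CellStep (hammockCells l w \ S)) c u
  let s : ℤ × ℤ → ZMod 2 := fun u =>
    if (u.1 + u.2) % 2 = i.residue then (if A u then 1 else 0) else (if C u then 1 else 0)
  have hres := i.residue_eq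
  have hother := i.residue_other
  have hA : ∀ u v, CellStep S u v → A u → A v := fun u v h ⟨a, ha, ha0, hau⟩ =>
    ⟨a, ha, ha0, hau.tail h⟩
  have hC : ∀ u v, CellStep (hammockCells l w \ S) u v → C u → C v :=
    fun u v h ⟨a, ha, ha0, hau⟩ => ⟨a, ha, ha0, hau.tail h⟩
  have hsA : ∀ u v, (u.1 + u.2) % 2 = i.residue → CellStep S u v → s u = s v := by
    intro u v hu huv
    have hv : (v.1 + v.2) % 2 = i.residue := by
      have := xGraph_adj_iff.1 huv.1
      omega
    simp only [s, if_pos hu, if_pos hv, propext ⟨hA u v huv, hA v u huv.symm⟩]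
  have hsC : ∀ u v, (u.1 + u.2) % 2 ≠ i.residue → CellStep (hammockCells l w \ S) u v →
      s u = s v := by
    intro u v hu huv
    have hv : (v.1 + v.2) % 2 ≠ i.residue := by
      have := xGraph_adj_iff.1 huv.1
      omega
    simp only [s, if_neg hu, if_neg hv, propext ⟨hC u v huv, hC v u huv.symm⟩]
  obtain ⟨x, hx, y, hy, h1, h2⟩ := exists_cell_of_boundary (fun x y => s (x, y)) l w
    i.residue.toNat
    (by
      intro y hy hp
      have hp' : ((0 : ℤ) + y) % 2 = i.residue := by omega
      simp only [s, Nat.cast_zero]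
      rw [if_pos hp', if_pos]
      exact ⟨(0, y), mem_hammockVertices.2 ⟨le_rfl, by simp, by simp, by simpa using hy, hp'⟩,
        rfl, .refl⟩)
    (by
      intro y hy hp
      have hp' : ((l : ℤ) + y) % 2 = i.residue := by omega
      simp only [s]
      rw [if_pos hp', if_neg]
      rintro ⟨a, ha, ha0, hab⟩
      exact h a _ ha ha0 rfl hab)
    (by
      intro x hx hp
      have hp' : ((x : ℤ) + 0) % 2 ≠ i.residue := by omega
      simp only [s, Nat.cast_zero]
      rw [if_neg hp', if_pos]
      exact ⟨(x, 0), mem_hammockVertices.2 ⟨by simp, by simpa using hx, le_rfl, by simp,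
        by simp only; omega⟩, rfl, .refl⟩)
    (by
      intro x hx hp
      have hp' : ((x : ℤ) + w) % 2 ≠ i.residue := by omega
      simp only [s]
      rw [if_neg hp', if_neg]
      rintro ⟨a, ha, ha0, hab⟩
      exact h' a _ ha ha0 rfl hab)
  have hcell : ((x : ℤ), (y : ℤ)) ∈ (hammockCells l w : Set (ℤ × ℤ)) := by
    rw [Finset.mem_coe, mem_hammockCells]
    simp only
    omega
  push_cast at h1 h2
  have hup : ∀ T : Set (ℤ × ℤ), ((x : ℤ), (y : ℤ)) ∈ T →
      CellStep T ((x : ℤ), (y : ℤ)) ((x : ℤ) + 1, (y : ℤ) + 1) := fun T hT =>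
    ⟨xGraph_adj_iff.2 (by simp), by simpa using hT⟩
  have hdown : ∀ T : Set (ℤ × ℤ), ((x : ℤ), (y : ℤ)) ∈ T →
      CellStep T ((x : ℤ) + 1, (y : ℤ)) ((x : ℤ), (y : ℤ) + 1) := fun T hT =>
    ⟨xGraph_adj_iff.2 (by simp), by simpa using hT⟩
  -- A cell in `S` lets its diagonal of kind `i` be traversed, any other cell its other diagonal;
  -- the parity of `x + y` tells which of them ascends.
  by_cases hS : ((x : ℤ), (y : ℤ)) ∈ S <;> by_cases hp : ((x : ℤ) + y) % 2 = i.residue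
  · exact h1 (hsA _ _ hp (hup S hS))
  · exact h2 (hsA _ _ (by simp only; omega) (hdown S hS))
  · exact h2 (hsC _ _ (by simp only; omega) (hdown _ ⟨hcell, hS⟩))
  · exact h1 (hsC _ _ hp (hup _ ⟨hcell, hS⟩))

/-! ### Transposition and duality of crossings. -/

/-- The cells in `S` contain a left-right path of kind `i`. -/
def CellCrossing (i : HammockKind) (l w : ℕ) (S : Set (ℤ × ℤ)) : Prop :=
  ∃ a b : ℤ × ℤ, a ∈ hammockVertices i l w ∧ a.1 = 0 ∧ b.1 = l ∧ ReflTransGen (CellStep S) a b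

theorem swap_mem_hammockVertices {i : HammockKind} {l w : ℕ} {v : ℤ × ℤ} :
    v.swap ∈ hammockVertices i w l ↔ v ∈ hammockVertices i l w := by
  simp only [mem_hammockVertices, Prod.fst_swap, Prod.snd_swap, add_comm v.2]
  tauto

theorem CellStep.swap {S : Set (ℤ × ℤ)} {u v : ℤ × ℤ} (h : CellStep S u v) :
    CellStep (Prod.swap ⁻¹' S) u.swap v.swap :=
  ⟨⟨h.1.2, h.1.1⟩, h.2⟩

theorem reflTransGen_cellStep_swap {S : Set (ℤ × ℤ)} {u v : ℤ × ℤ} :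
    ReflTransGen (CellStep (Prod.swap ⁻¹' S)) u.swap v.swap ↔ ReflTransGen (CellStep S) u v :=
  ⟨fun h => ReflTransGen.lift Prod.swap (fun _ _ => CellStep.swap) _ _ h,
    fun h => ReflTransGen.lift Prod.swap (fun _ _ => CellStep.swap) _ _ h⟩

theorem cellCrossing_other_swap_iff {i : HammockKind} {l w : ℕ} {S : Set (ℤ × ℤ)} :
    CellCrossing i.other w l (Prod.swap ⁻¹' S) ↔
      ∃ c d : ℤ × ℤ, c ∈ hammockVertices i.other l w ∧ c.2 = 0 ∧ d.2 = w ∧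
        ReflTransGen (CellStep S) c d := by
  simp only [CellCrossing]
  rw [← Equiv.exists_congr_right (Equiv.prodComm ℤ ℤ)]
  refine exists_congr fun c => ?_
  rw [← Equiv.exists_congr_right (Equiv.prodComm ℤ ℤ)]
  refine exists_congr fun d => ?_
  simp only [Equiv.prodComm_apply, swap_mem_hammockVertices, Prod.fst_swap,
    reflTransGen_cellStep_swap]

/-- Duality of crossings. -/
theorem cellCrossing_other_iff_not {i : HammockKind} {l w : ℕ} (hl : 1 ≤ l) {S : Set (ℤ × ℤ)}
    (hS : S ⊆ hammockCells l w) :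
    CellCrossing i.other w l (Prod.swap ⁻¹' (hammockCells l w \ S)) ↔ ¬ CellCrossing i l w S := by
  rw [cellCrossing_other_swap_iff]
  refine ⟨?_, exists_crossing⟩
  rintro ⟨c, d, hc, hc0, hd, hcd⟩ ⟨a, b, ha, ha0, hb, hab⟩
  exact not_disjoint_of_crossing hl hS Set.sdiff_subset ha ha0 hb hab hc hc0 hd hcd
    Set.disjoint_sdiff_right

/-! ### Reliability polynomials under renaming of edges and isomorphism. -/

namespace Network
variable {V : Type*}

open Classical in
/-- The reliability polynomial, written as a sum over sets of names of the edges. -/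
theorem reliabilityPolynomial_eq_sum [Fintype V] {ι : Type*} (N : Network V) (c : Sym2 V → ι)
    (T : Finset ι) (hc : Set.BijOn c N.graph.edgeSet T) :
    N.reliabilityPolynomial =
      ∑ S ∈ T.powerset.filter fun S => N.IsPathset {e | e ∈ N.graph.edgeSet ∧ c e ∈ S},
        Polynomial.X ^ S.card * (1 - Polynomial.X) ^ (T.card - S.card) := by
  have hT : N.graph.edgeFinset.card = T.card :=
    Finset.card_nbij c (fun e he => hc.mapsTo (by simpa using he))
      (by simpa using hc.injOn) (by simpa using hc.surjOn)
  have himage : ∀ P ⊆ N.graph.edgeFinset, N.graph.edgeFinset.filter (c · ∈ P.image c) = P := by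
    intro P hP
    ext e
    simp only [Finset.mem_filter, Finset.mem_image, SimpleGraph.mem_edgeFinset]
    constructor
    · rintro ⟨he, e', he', h⟩
      rwa [← hc.injOn (by simpa using hP he') he h]
    · exact fun he => ⟨by simpa using hP he, e, he, rfl⟩
  have hset : ∀ S : Finset ι, {e | e ∈ N.graph.edgeSet ∧ c e ∈ S} =
      ((N.graph.edgeFinset.filter (c · ∈ S) : Finset (Sym2 V)) : Set (Sym2 V)) := by
    intro S
    ext e
    simp
  refine Finset.sum_nbij' (fun P => P.image c) (fun S => N.graph.edgeFinset.filter (c · ∈ S))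
    ?_ ?_ ?_ ?_ ?_
  · intro P hP
    rw [Finset.mem_filter, Finset.mem_powerset] at hP ⊢
    refine ⟨?_, ?_⟩
    · intro x hx
      obtain ⟨e, he, rfl⟩ := Finset.mem_image.1 hx
      exact hc.mapsTo (by simpa using hP.1 he)
    · rw [hset, himage P hP.1]
      exact hP.2
  · intro S hS
    rw [Finset.mem_filter, Finset.mem_powerset] at hS ⊢
    exact ⟨Finset.filter_subset _ _, hset S ▸ hS.2⟩
  · intro P hP
    exact himage P (Finset.mem_powerset.1 (Finset.mem_filter.1 hP).1)
  · intro S hS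
    have hS := Finset.mem_powerset.1 (Finset.mem_filter.1 hS).1
    ext x
    simp only [Finset.mem_filter, Finset.mem_image, SimpleGraph.mem_edgeFinset]
    constructor
    · rintro ⟨e, he, rfl⟩
      exact he.2
    · intro hx
      obtain ⟨e, he, rfl⟩ := hc.surjOn (hS hx)
      exact ⟨e, ⟨he, hx⟩, rfl⟩
  · intro P hP
    have hP := Finset.mem_powerset.1 (Finset.mem_filter.1 hP).1
    rw [hT, Finset.card_image_of_injOn]
    exact hc.injOn.mono fun e he => by simpa using hP he

variable {W : Type*}

theorem IsPathset.map {N : Network V} {M : Network W} (φ : N.graph ≃g M.graph)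
    (h : (φ '' N.sources = M.sources ∧ φ '' N.termini = M.termini) ∨
      (φ '' N.sources = M.termini ∧ φ '' N.termini = M.sources))
    {P : Set (Sym2 V)} {Q : Set (Sym2 W)} (hP : N.IsPathset P) (hQ : Q ⊆ M.graph.edgeSet)
    (hPQ : ∀ e ∈ P, Sym2.map φ e ∈ Q) : M.IsPathset Q := by
  obtain ⟨-, s, hs, t, ht, γ, hγ, hγP⟩ := hP
  have hpath : (γ.map φ.toHom).IsPath := hγ.map φ.injective
  have hedge : ∀ e ∈ (γ.map φ.toHom).edges, e ∈ Q := by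
    intro e he
    rw [SimpleGraph.Walk.edges_map, List.mem_map] at he
    obtain ⟨e', he', rfl⟩ := he
    exact hPQ e' (hγP e' he')
  refine ⟨hQ, ?_⟩
  rcases h with ⟨h1, h2⟩ | ⟨h1, h2⟩
  · exact ⟨φ s, h1 ▸ ⟨s, hs, rfl⟩, φ t, h2 ▸ ⟨t, ht, rfl⟩, γ.map φ.toHom, hpath, hedge⟩
  · exact ⟨φ t, h2 ▸ ⟨t, ht, rfl⟩, φ s, h1 ▸ ⟨s, hs, rfl⟩, (γ.map φ.toHom).reverse,
      hpath.reverse, by simpa using hedge⟩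

/-- Isomorphic networks have the same reliability polynomial. -/
theorem Isomorphic.reliabilityPolynomial_eq [Fintype V] [Fintype W] {N : Network V}
    {M : Network W} (h : N.Isomorphic M) : N.reliabilityPolynomial = M.reliabilityPolynomial := by
  classical
  obtain ⟨φ, h⟩ := h
  have hsymm : (φ.symm '' M.sources = N.sources ∧ φ.symm '' M.termini = N.termini) ∨
      (φ.symm '' M.sources = N.termini ∧ φ.symm '' M.termini = N.sources) := by
    have e : ∀ s : Set V, φ.symm '' (φ '' s) = s := fun s => by simp [Set.image_image]
    rcases h with ⟨h1, h2⟩ | ⟨h1, h2⟩ <;> simp [← h1, ← h2, e]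
  have hmem : ∀ e, Sym2.map φ e ∈ M.graph.edgeSet ↔ e ∈ N.graph.edgeSet := by
    intro e
    induction e with | _ u v => exact φ.map_adj_iff
  rw [N.reliabilityPolynomial_eq_sum (Sym2.map φ) M.graph.edgeFinset]
  · rw [reliabilityPolynomial]
    refine Finset.sum_congr (Finset.filter_congr fun P hP => ?_) fun _ _ => rfl
    have hP : ∀ e ∈ P, e ∈ M.graph.edgeSet := fun e he => by
      simpa using Finset.mem_powerset.1 hP he
    constructor
    · exact fun hN => hN.map φ h hP fun e he => he.2
    · refine fun hM => hM.map φ.symm hsymm (fun e he => he.1) fun e he => ?_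
      have : Sym2.map φ (Sym2.map φ.symm e) = e := by simp [Sym2.map_map]
      exact ⟨(hmem _).1 (this.symm ▸ hP e he), this.symm ▸ he⟩
  · refine ⟨fun e he => by simpa using (hmem e).2 he, (Sym2.map.injective φ.injective).injOn, ?_⟩
    intro e he
    have : Sym2.map φ (Sym2.map φ.symm e) = e := by simp [Sym2.map_map]
    exact ⟨_, (hmem _).1 (this.symm ▸ by simpa using he), this⟩

end Network

/-! ### From edges and pathsets to cells and crossings. -/

/-- The lower left corner of the unit cell of an edge. -/
noncomputable def edgeCell {s : Finset (ℤ × ℤ)} : Sym2 s → ℤ × ℤ :=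
  Sym2.lift ⟨fun u v => (min u.1.1 v.1.1, min u.1.2 v.1.2), fun u v => by
    dsimp only
    rw [min_comm u.1.1, min_comm u.1.2]⟩

theorem edgeCell_mk {s : Finset (ℤ × ℤ)} (u v : s) :
    edgeCell s(u, v) = (min u.1.1 v.1.1, min u.1.2 v.1.2) := rfl

theorem hammock_adj {i : HammockKind} {l w : ℕ} {u v : hammockVertices i l w} :
    (hammock i l w).graph.Adj u v ↔ xGraph.Adj u.1 v.1 := Iff.rfl

theorem edgeCell_bijOn (i : HammockKind) (l w : ℕ) :
    Set.BijOn edgeCell (hammock i l w).graph.edgeSet (hammockCells l w) := by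
  have hres := i.residue_eq
  refine ⟨?_, ?_, ?_⟩
  · intro e he
    induction e with | _ u v =>
    have hadj := xGraph_adj_iff.1 ((hammock_adj (u := u) (v := v)).1 he)
    have hu := mem_hammockVertices.1 u.2
    have hv := mem_hammockVertices.1 v.2
    rw [edgeCell_mk, Finset.mem_coe, mem_hammockCells]
    dsimp only
    omega
  · intro e he e' he' h
    induction e with | _ u v =>
    induction e' with | _ u' v' =>
    have hadj := xGraph_adj_iff.1 ((hammock_adj (u := u) (v := v)).1 he)
    have hadj' := xGraph_adj_iff.1 ((hammock_adj (u := u') (v := v')).1 he')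
    have hu := (mem_hammockVertices.1 u.2).2.2.2.2
    have hu' := (mem_hammockVertices.1 u'.2).2.2.2.2
    rw [edgeCell_mk, edgeCell_mk, Prod.mk.injEq] at h
    rw [Sym2.eq_iff]
    simp only [Subtype.ext_iff, Prod.ext_iff]
    obtain ⟨h1, h2⟩ := h
    obtain ⟨hx, hy⟩ := hadj
    obtain ⟨hx', hy'⟩ := hadj'
    -- The ends of an edge lie on opposite vertical sides of its cell, so first coordinates match
    -- the ends; parity then settles the heights.
    by_cases hu1 : u.1.1 = u'.1.1
    · have hv1 : v.1.1 = v'.1.1 := by omega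
      have hu2 : u.1.2 = u'.1.2 := by omega
      exact .inl ⟨⟨hu1, hu2⟩, hv1, by omega⟩
    · have hv1 : u.1.1 = v'.1.1 := by omega
      have hv2 : v.1.1 = u'.1.1 := by omega
      have hu2 : u.1.2 = v'.1.2 := by omega
      exact .inr ⟨⟨hv1, hu2⟩, hv2, by omega⟩
  · intro c hc
    have hc := mem_hammockCells.1 hc
    by_cases hp : (c.1 + c.2) % 2 = i.residue
    · refine ⟨s(⟨c, mem_hammockVertices.2 (by omega)⟩,
        ⟨(c.1 + 1, c.2 + 1), mem_hammockVertices.2 (by dsimp only; omega)⟩), ?_, ?_⟩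
      · exact hammock_adj.2 (xGraph_adj_iff.2 (by simp))
      · rw [edgeCell_mk]
        ext <;> simp
    · refine ⟨s(⟨(c.1 + 1, c.2), mem_hammockVertices.2 (by dsimp only; omega)⟩,
        ⟨(c.1, c.2 + 1), mem_hammockVertices.2 (by dsimp only; omega)⟩), ?_, ?_⟩
      · exact hammock_adj.2 (xGraph_adj_iff.2 (by simp))
      · rw [edgeCell_mk]
        ext <;> simp

theorem reflTransGen_cellStep_of_walk {i : HammockKind} {l w : ℕ} {S : Set (ℤ × ℤ)}
    {u v : hammockVertices i l w} (γ : (hammock i l w).graph.Walk u v)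
    (h : ∀ e ∈ γ.edges, edgeCell e ∈ S) : ReflTransGen (CellStep S) u.1 v.1 := by
  induction γ with
  | nil => exact .refl
  | cons hadj γ ih =>
    rw [SimpleGraph.Walk.edges_cons, List.forall_mem_cons] at h
    exact (ih h.2).head ⟨hadj, h.1⟩

theorem exists_walk_of_reflTransGen {i : HammockKind} {l w : ℕ} {S : Set (ℤ × ℤ)}
    (hS : S ⊆ hammockCells l w) {a b : ℤ × ℤ} (h : ReflTransGen (CellStep S) a b)
    (ha : a ∈ hammockVertices i l w) (hb : b ∈ hammockVertices i l w) :
    ∃ γ : (hammock i l w).graph.Walk ⟨a, ha⟩ ⟨b, hb⟩, ∀ e ∈ γ.edges, edgeCell e ∈ S := by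
  induction h using ReflTransGen.head_induction_on with
  | refl => exact ⟨.nil, by simp⟩
  | @head a c hac _ ih =>
    obtain ⟨γ, hγ⟩ := ih (hac.mem_hammockVertices hS ha)
    refine ⟨.cons (hammock_adj.2 hac.1) γ, ?_⟩
    rw [SimpleGraph.Walk.edges_cons, List.forall_mem_cons]
    exact ⟨hac.2, hγ⟩

theorem isPathset_hammock_iff {i : HammockKind} {l w : ℕ} {S : Set (ℤ × ℤ)}
    (hS : S ⊆ hammockCells l w) :
    (hammock i l w).IsPathset {e | e ∈ (hammock i l w).graph.edgeSet ∧ edgeCell e ∈ S} ↔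
      CellCrossing i l w S := by
  classical
  constructor
  · rintro ⟨-, s, hs, t, ht, γ, -, hγ⟩
    exact ⟨s, t, s.2, hs, ht, reflTransGen_cellStep_of_walk γ fun e he => (hγ e he).2⟩
  · rintro ⟨a, b, ha, ha0, hb, hab⟩
    obtain ⟨γ, hγ⟩ := exists_walk_of_reflTransGen hS hab ha
      (mem_hammockVertices_of_reflTransGen hS hab ha)
    exact ⟨fun e he => he.1, _, ha0, _, hb, γ.bypass, γ.bypass_isPath, fun e he =>
      ⟨γ.bypass.edges_subset_edgeSet he, hγ e (γ.edges_bypass_subset_edges he)⟩⟩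

open Classical in
theorem hammockPoly_eq_sum (i : HammockKind) (l w : ℕ) :
    hammockPoly i l w =
      ∑ S ∈ (hammockCells l w).powerset.filter fun S : Finset (ℤ × ℤ) => CellCrossing i l w (S : Set (ℤ × ℤ)),
        Polynomial.X ^ S.card * (1 - Polynomial.X) ^ ((hammockCells l w).card - S.card) := by
  rw [hammockPoly, Network.reliabilityPolynomial_eq_sum _ edgeCell _ (edgeCell_bijOn i l w)]
  refine Finset.sum_congr (Finset.filter_congr fun S hS => ?_) fun _ _ => rfl
  exact isPathset_hammock_iff (Finset.coe_subset.2 (Finset.mem_powerset.1 hS))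

/-! ### Duality of the polynomials. -/

theorem swap_mem_hammockCells {l w : ℕ} {c : ℤ × ℤ} :
    c.swap ∈ hammockCells w l ↔ c ∈ hammockCells l w := by
  simp only [mem_hammockCells, Prod.fst_swap, Prod.snd_swap]
  tauto

/-- The transposed complement of a set of cells. -/
noncomputable def dualCells (l w : ℕ) (S : Finset (ℤ × ℤ)) : Finset (ℤ × ℤ) :=
  (hammockCells l w \ S).map (Equiv.prodComm ℤ ℤ).toEmbedding

theorem mem_dualCells {l w : ℕ} {S : Finset (ℤ × ℤ)} {c : ℤ × ℤ} :
    c ∈ dualCells l w S ↔ c ∈ hammockCells w l ∧ c.swap ∉ S := by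
  rw [dualCells, Finset.mem_map_equiv, Finset.mem_sdiff]
  exact and_congr_left fun _ => swap_mem_hammockCells

theorem coe_dualCells {l w : ℕ} {S : Finset (ℤ × ℤ)} :
    (dualCells l w S : Set (ℤ × ℤ)) = Prod.swap ⁻¹' ((hammockCells l w : Set (ℤ × ℤ)) \ S) := by
  ext c
  simp [mem_dualCells, swap_mem_hammockCells]

theorem dualCells_subset {l w : ℕ} {S : Finset (ℤ × ℤ)} : dualCells l w S ⊆ hammockCells w l :=
  fun _ h => (mem_dualCells.1 h).1

theorem dualCells_dualCells {l w : ℕ} {S : Finset (ℤ × ℤ)} (hS : S ⊆ hammockCells l w) :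
    dualCells w l (dualCells l w S) = S := by
  ext c
  simp only [mem_dualCells, swap_mem_hammockCells, Prod.swap_swap]
  have := @hS c
  tauto

theorem card_dualCells {l w : ℕ} {S : Finset (ℤ × ℤ)} (hS : S ⊆ hammockCells l w) :
    (dualCells l w S).card = (hammockCells l w).card - S.card := by
  rw [dualCells, Finset.card_map, Finset.card_sdiff_of_subset hS]

theorem card_hammockCells (l w : ℕ) : (hammockCells l w).card = l * w := by
  simp [hammockCells]

/-- The reliability polynomials of dual hammock networks. -/
theorem eval_hammockPoly_other (i : HammockKind) {l w : ℕ} (hl : 1 ≤ l) (p : ℝ) :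
    (hammockPoly i l w).eval p = 1 - (hammockPoly i.other w l).eval (1 - p) := by
  classical
  have hdual : (hammockPoly i.other w l).eval (1 - p) =
      ∑ S ∈ (hammockCells l w).powerset.filter fun S : Finset (ℤ × ℤ) => ¬ CellCrossing i l w (S : Set (ℤ × ℤ)),
        p ^ S.card * (1 - p) ^ ((hammockCells l w).card - S.card) := by
    rw [hammockPoly_eq_sum, Polynomial.eval_finsetSum]
    refine Finset.sum_nbij' (dualCells w l) (dualCells l w) ?_ ?_ ?_ ?_ ?_
    · intro S hS
      rw [Finset.mem_filter, Finset.mem_powerset] at hS ⊢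
      refine ⟨dualCells_subset, ?_⟩
      rw [← cellCrossing_other_iff_not hl (Finset.coe_subset.2 dualCells_subset),
        ← coe_dualCells, dualCells_dualCells hS.1]
      exact hS.2
    · intro S hS
      rw [Finset.mem_filter, Finset.mem_powerset] at hS ⊢
      refine ⟨dualCells_subset, ?_⟩
      rw [coe_dualCells, cellCrossing_other_iff_not hl (Finset.coe_subset.2 hS.1)]
      exact hS.2
    · exact fun S hS => dualCells_dualCells (Finset.mem_powerset.1 (Finset.mem_filter.1 hS).1)
    · exact fun S hS => dualCells_dualCells (Finset.mem_powerset.1 (Finset.mem_filter.1 hS).1)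
    · intro S hS
      have hS := Finset.mem_powerset.1 (Finset.mem_filter.1 hS).1
      have hcard := Finset.card_le_card hS
      have e : (hammockCells l w).card - (dualCells w l S).card = S.card := by
        rw [card_dualCells hS, card_hammockCells l w, mul_comm l w, ← card_hammockCells w l]
        omega
      rw [e, card_dualCells hS]
      simp [mul_comm]
  rw [hdual, hammockPoly_eq_sum, Polynomial.eval_finsetSum, eq_sub_iff_add_eq]
  simp only [Polynomial.eval_mul, Polynomial.eval_pow, Polynomial.eval_sub, Polynomial.eval_one,
    Polynomial.eval_X]
  -- Together the two sums run over all sets of cells and give `(p + (1 - p)) ^ n = 1`.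
  rw [Finset.sum_filter_add_sum_filter_not, Finset.sum_pow_mul_eq_add_pow]
  simp

/-! ### Reflections and symmetry of the graphs. -/

/-- An involution of the plane that reverses the parity and respects the diagonal steps and the
pair of sides of a rectangle gives an isomorphism of the two hammock networks. -/
theorem hammock_isomorphic_of_involutive {l w : ℕ} {f : ℤ × ℤ → ℤ × ℤ}
    (hf : Function.Involutive f) (hadj : ∀ u v, xGraph.Adj u v → xGraph.Adj (f u) (f v))
    (hV : ∀ i v, v ∈ hammockVertices i l w → f v ∈ hammockVertices i.other l w)
    (hside : (∀ v, ((f v).1 = 0 ↔ v.1 = 0) ∧ ((f v).1 = l ↔ v.1 = l)) ∨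
      (∀ v, ((f v).1 = 0 ↔ v.1 = l) ∧ ((f v).1 = l ↔ v.1 = 0))) :
    (hammock .first l w).Isomorphic (hammock .second l w) := by
  let φ : (hammock .first l w).graph ≃g (hammock .second l w).graph :=
    { toFun := fun v => ⟨f v, hV .first v v.2⟩
      invFun := fun v => ⟨f v, hV .second v v.2⟩
      left_inv := fun v => Subtype.ext (hf v)
      right_inv := fun v => Subtype.ext (hf v)
      map_rel_iff' := fun {u v} =>
        ⟨fun h => by
          have := hadj _ _ (hammock_adj.1 h)
          rw [hammock_adj]
          simpa only [Equiv.coe_fn_mk, hf _] using this, fun h => hadj _ _ h⟩ }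
  have himage : ∀ s : Set (hammockVertices .first l w), φ '' s = {v | φ.symm v ∈ s} :=
    fun s => φ.toEquiv.image_eq_preimage_symm s
  refine ⟨φ, hside.imp (fun h => ?_) fun h => ?_⟩
  · rw [himage, himage]
    exact ⟨Set.ext fun v => (h v).1, Set.ext fun v => (h v).2⟩
  · rw [himage, himage]
    exact ⟨Set.ext fun v => (h v).1, Set.ext fun v => (h v).2⟩

/-- Reflecting a coordinate of odd range changes the parity of `x + y`. The horizontal reflection
exchanges sources and termini, the vertical one preserves both. -/
theorem hammock_isomorphic {l w : ℕ} (h : Odd l ∨ Odd w) :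
    (hammock .first l w).Isomorphic (hammock .second l w) := by
  rcases h with h | h <;> rw [Nat.odd_iff] at h
  · refine hammock_isomorphic_of_involutive (f := fun v => (l - v.1, v.2))
      (fun v => by simp) (fun u v huv => ?_) (fun i v hv => ?_) (.inr fun v => ?_)
    · rw [xGraph_adj_iff] at huv ⊢
      dsimp only
      omega
    · have := i.residue_eq
      rw [mem_hammockVertices, HammockKind.residue_other] at *
      dsimp only
      omega
    · dsimp only
      omega
  · refine hammock_isomorphic_of_involutive (f := fun v => (v.1, w - v.2))
      (fun v => by simp) (fun u v huv => ?_) (fun i v hv => ?_)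
      (.inl fun v => ⟨Iff.rfl, Iff.rfl⟩)
    · rw [xGraph_adj_iff] at huv ⊢
      dsimp only
      omega
    · have := i.residue_eq
      rw [mem_hammockVertices] at *
      rw [HammockKind.residue_other]
      dsimp only
      omega

theorem pointReflection_image_graphOn {f g : ℝ → ℝ} (h : ∀ p, f p = 1 - g (1 - p)) :
    Equiv.pointReflection ((1 / 2, 1 / 2) : ℝ × ℝ) '' (Set.Icc (0 : ℝ) 1).graphOn f =
      (Set.Icc (0 : ℝ) 1).graphOn g := by
  ext ⟨x, y⟩
  simp only [Equiv.image_eq_preimage_symm, Equiv.pointReflection_symm, Set.mem_preimage,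
    Set.mem_graphOn, Equiv.pointReflection_apply, Set.mem_Icc]
  simp only [Prod.fst_add, Prod.snd_add, vsub_eq_sub, vadd_eq_add, Prod.fst_sub, Prod.snd_sub, h]
  have e : (1 : ℝ) / 2 - x + 1 / 2 = 1 - x := by ring
  rw [e, sub_sub_cancel]
  constructor <;> rintro ⟨⟨h1, h2⟩, h3⟩ <;> refine ⟨⟨?_, ?_⟩, ?_⟩ <;> linarith

theorem corollary3 :
    (∀ l w : ℕ, 1 ≤ l → 1 ≤ w → (Odd l ∨ Odd w) →
      (hammock .first l w).Isomorphic (hammock .second l w) ∧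
      hammockPoly .first l w = hammockPoly .second l w ∧
      (∀ i j : HammockKind, ∀ p ∈ Set.Icc (0 : ℝ) 1,
        (hammockPoly i l w).eval p = 1 - (hammockPoly j w l).eval (1 - p)) ∧
      (∀ i j : HammockKind,
        Equiv.pointReflection ((1 / 2, 1 / 2) : ℝ × ℝ) '' hammockPlot i l w =
          hammockPlot j w l)) ∧
    (∀ k : ℕ, ∀ i : HammockKind,
      Equiv.pointReflection ((1 / 2, 1 / 2) : ℝ × ℝ) ''
          hammockPlot i (2 * k + 1) (2 * k + 1) =
        hammockPlot i (2 * k + 1) (2 * k + 1)) := by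
  have hpoly : ∀ l w : ℕ, (Odd l ∨ Odd w) → ∀ i j : HammockKind,
      hammockPoly i l w = hammockPoly j l w := by
    intro l w h i j
    have e : hammockPoly .first l w = hammockPoly .second l w :=
      (hammock_isomorphic h).reliabilityPolynomial_eq
    cases i <;> cases j <;> simp [e]
  have hdual : ∀ l w : ℕ, 1 ≤ l → (Odd l ∨ Odd w) → ∀ i j : HammockKind, ∀ p : ℝ,
      (hammockPoly i l w).eval p = 1 - (hammockPoly j w l).eval (1 - p) := by
    intro l w hl h i j p
    rw [eval_hammockPoly_other i hl, hpoly w l h.symm j i.other]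
  refine ⟨fun l w hl _ h => ⟨hammock_isomorphic h, hpoly l w h _ _, fun i j p _ =>
    hdual l w hl h i j p, fun i j => pointReflection_image_graphOn (hdual l w hl h i j)⟩,
    fun k i => ?_⟩
  exact pointReflection_image_graphOn
    (hdual _ _ (by omega) (.inl (odd_two_mul_add_one k)) i i)
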